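/- Let $(\Omega,\mathcal F)$ be a measurable space, $\mu\neq 0$ a measure on it, $X_1,\dots,X_n$ real measurable functions on $\Omega$, and $\Theta\subset\mathbb R^n$ an open set such that $\exp(-\sum_j\beta^jX_j)$ is $\mu$-integrable for every $\beta\in\Theta$. Suppose that the probability distributions $p_\beta=\exp(-\sum_j\beta^jX_j)\,\mu\big/\int\exp(-\sum_j\beta^jX_j)\,d\mu$, $\beta\in\Theta$, are pairwise distinct, so that $\beta$ is a coordinate system on this exponential family of distributions. Let $$\Phi(\beta)=\ln\int_\Omega \exp\Big(-\sum_j\beta^jX_j\Big)\,d\mu,\qquad g_{ij}=\partial_i\partial_j\Phi,\qquad \Phi_{abc}=\partial_a\partial_b\partial_c\Phi ,$$ and suppose that the family is a Frobenius manifold (the information geometry Frobenius manifold), i.e. that the multiplication of tangent vectors $\partial_a\circ\partial_b=\sum_{e,f}\Phi_{abe}\,g^{ef}\partial_f$ is associative: for all $a,b,c,d$, on $\Theta$, $$\sum_{e,f}\Phi_{abe}\,g^{ef}\,\Phi_{fcd}=\sum_{e,f}\Phi_{bce}\,g^{ef}\,\Phi_{fad}.$$ Let $\mathfrak C=\mathbb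 R+e\mathbb R$, $e^2=1$, be the algebra of paracomplex numbers, with $\overline{x+ey}=x-ey$ and $\operatorname{Im}(x+ey)=y$, and consider the paracomplex phase space $$M=\{z=x+ey\in\mathfrak C^n : x\in\Theta,\ y\in\mathbb R^n\},$$ a real manifold of dimension $2n$ (the tangent bundle of the family). Let $\langle\xi,\eta\rangle_{\mathfrak C}=\sum_{j,k} g_{jk}(x)\,\xi^j\,\overline{\eta^k}$ be the paracomplex Hermitian product on its tangent spaces $T_zM\cong\mathfrak C^n$, and let $$\Omega_{\mathfrak C}=\frac e2\sum_{j,k} g_{jk}(x)\,dz^j\wedge d\overline z^k ,\qquad (\alpha\wedge\beta)(\xi,\eta)=\tfrac12\big(\alpha(\xi)\beta(\eta)-\alpha(\eta)\beta(\xi)\big).$$ Then $M$ is a Poisson manifold, with a Poisson structure that comes from the symplectic form $\Omega_{\mathfrak C}$ and is given by the imaginary part of the Hermitian product. Precisely: 1. $\Omega_{\mathfrak C}$ is a real-valued symplectic form on $M$ (smooth, closed, nondegenerate), and $\Omega_{\mathfrak C}(\xi,\eta)=\{\xi,\eta\}_{\mathfrak C}:=\tfrac12\operatorname{Im}\langle\xi,\eta\rangle_{\mathfrak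 C}$ for all tangent vectors $\xi,\eta$. 2. Every $f\in C^\infty(M,\mathbb R)$ has a smooth symplectic gradient, i.e. a smooth vector field $X_f$ with $\Omega_{\mathfrak C}(\xi,X_f)=df(\xi)$ for every tangent vector $\xi$. 3. There is a Poisson structure $\{\cdot,\cdot\}$ on $M$ (a Lie bracket on the real vector space $C^\infty(M,\mathbb R)$ that is a derivation in each argument for the pointwise product) such that, for all $f,h\in C^\infty(M,\mathbb R)$, $$\{f,h\}=X_f(h)=\{X_f,X_h\}_{\mathfrak C}=\tfrac12\operatorname{Im}\langle X_f,X_h\rangle_{\mathfrak C}.$$ -/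

import Mathlib

open MeasureTheory
open scoped Manifold ContDiff

/-- A Poisson structure on a smooth manifold `M`: a Lie bracket on the real vector space of smooth
functions on `M` which is a derivation in each argument for the pointwise product. -/
structure PoissonStructure {E H : Type*} [NormedAddCommGroup E] [NormedSpace ℝ E]
    [TopologicalSpace H] (I : ModelWithCorners ℝ E H) (M : Type*) [TopologicalSpace M]
    [ChartedSpace H M] where
  /-- the bracket, bilinear over `ℝ` -/
  bracket : C^∞⟮I, M; 𝓘(ℝ), ℝ⟯ →ₗ[ℝ] C^∞⟮I, M; 𝓘(ℝ), ℝ⟯ →ₗ[ℝ] C^∞⟮I, M; 𝓘(ℝ), ℝ⟯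
  alternating : ∀ f, bracket f f = 0
  jacobi : ∀ f g h,
    bracket f (bracket g h) + bracket g (bracket h f) + bracket h (bracket f g) = 0
  leibniz : ∀ f g h, bracket f (g * h) = bracket f g * h + g * bracket f h

/-- A smooth real 2-form on an open set `D` of a real normed space is symplectic if it is closed
and nondegenerate. -/
def IsSymplecticForm {V : Type*} [NormedAddCommGroup V] [NormedSpace ℝ V]
    (D : TopologicalSpace.Opens V) (w : V → V [⋀^Fin 2]→L[ℝ] ℝ) : Prop :=
  ContDiffOn ℝ ∞ w D ∧ (∀ z ∈ D, extDeriv w z = 0) ∧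
    ∀ z ∈ D, ∀ ξ : V, (∀ η : V, w z ![ξ, η] = 0) → ξ = 0

/-- The algebra `ℝ + eℝ`, `e² = 1`, of paracomplex numbers; `star` is the conjugation
`x + e y ↦ x - e y`. -/
abbrev Paracomplex : Type := QuadraticAlgebra ℝ 1 0

namespace Paracomplex

/-- The paracomplex unit `e`. -/
def e : Paracomplex := ⟨0, 1⟩

theorem e_mul_e : e * e = 1 := by
  ext <;> simp [e, QuadraticAlgebra.re_one, QuadraticAlgebra.im_one]

theorem star_mk (x y : ℝ) : star (⟨x, y⟩ : Paracomplex) = ⟨x, -y⟩ := by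
  ext <;> simp

/-- The real realisation of the paracomplex space of dimension `n`: the pair `(x, y)` stands for
the point (or vector) with paracomplex coordinates `z^k = x^k + e y^k`. -/
abbrev Space (n : ℕ) : Type := (Fin n → ℝ) × (Fin n → ℝ)

/-- The `k`-th paracomplex coordinate `x^k + e y^k`. -/
def coord {n : ℕ} (v : Space n) (k : Fin n) : Paracomplex := ⟨v.1 k, v.2 k⟩

end Paracomplex

/-- The partial derivative `∂_i f`. -/
noncomputable def partialD {n : ℕ} (i : Fin n) (f : (Fin n → ℝ) → ℝ) (β : Fin n → ℝ) : ℝ :=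
  fderiv ℝ f β (Pi.single i 1)

/-- An exponential family of probability distributions on `Ω`, dominated by the measure `μ`, with
statistics `X_j` and parameters `β` in an open set `Θ`: the distributions are
`exp (-∑ β^j X_j) dμ / ∫ exp (-∑ β^j X_j) dμ`, and `β` is a coordinate system on the manifold of
these distributions. -/
structure ExponentialFamily (Ω : Type*) [MeasurableSpace Ω] (n : ℕ) where
  μ : Measure Ω
  X : Fin n → Ω → ℝ
  Θ : TopologicalSpace.Opens (Fin n → ℝ)
  μ_ne_zero : μ ≠ 0
  measurable_X : ∀ j, Measurable (X j)
  integrable_exp : ∀ β ∈ Θ, Integrable (fun x => Real.exp (-∑ j, β j * X j x)) μ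
  injOn_tilted : Set.InjOn (fun β : Fin n → ℝ => μ.tilted fun x => -∑ j, β j * X j x)
    (Θ : Set (Fin n → ℝ))

namespace ExponentialFamily

open Paracomplex

variable {Ω : Type*} [MeasurableSpace Ω] {n : ℕ} (S : ExponentialFamily Ω n)

/-- The potential `Φ(β) = log ∫ exp (-∑ β^j X_j) dμ`. -/
noncomputable def potential (β : Fin n → ℝ) : ℝ :=
  Real.log (∫ x, Real.exp (-∑ j, β j * S.X j x) ∂S.μ)

/-- The metric (Fisher metric) `g_{ij} = ∂_i ∂_j Φ`. -/
noncomputable def metric (β : Fin n → ℝ) : Matrix (Fin n) (Fin n) ℝ :=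
  Matrix.of fun i j => partialD i (partialD j S.potential) β

/-- The rank three tensor `t(∂_a, ∂_b, ∂_c) = ∂_a ∂_b ∂_c Φ`. -/
noncomputable def tensor (a b c : Fin n) (β : Fin n → ℝ) : ℝ :=
  partialD a (partialD b (partialD c S.potential)) β

/-- The family is a Frobenius manifold: the multiplication of tangent vectors
`∂_a ∘ ∂_b = ∑ Φ_{abe} g^{ef} ∂_f`, determined by `g(u ∘ v, w) = t(u, v, w)`, is associative, which
is the system of Witten-Dijkgraaf-Verlinde-Verlinde equations for the potential `Φ`. -/
def IsFrobenius : Prop :=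
  ∀ β ∈ S.Θ, ∀ a b c d : Fin n,
    ∑ i, ∑ j, S.tensor a b i β * (S.metric β)⁻¹ i j * S.tensor j c d β =
      ∑ i, ∑ j, S.tensor b c i β * (S.metric β)⁻¹ i j * S.tensor j a d β

/-- The phase space: the paracomplex domain of all `z = x + e y` with `x ∈ Θ`. As a real manifold
it is the tangent bundle of the manifold of distributions, `y` being the coordinates of a tangent
vector at `x`. -/
def phaseSpace : TopologicalSpace.Opens (Space n) :=
  ⟨{z | z.1 ∈ S.Θ}, S.Θ.isOpen.preimage continuous_fst⟩

/-- The paracomplex Hermitian product `⟨ξ, η⟩ = g_{jk} ξ^j conj(η^k)` of tangent vectors at `z`. -/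
noncomputable def hermitian (z ξ η : Space n) : Paracomplex :=
  ∑ j, ∑ k, algebraMap ℝ Paracomplex (S.metric z.1 j k) * coord ξ j * star (coord η k)

/-- The 2-form `(e / 2) g_{jk} dz^j ∧ d(conj z)^k`, with
`(α ∧ β) (ξ, η) = (α(ξ) β(η) - α(η) β(ξ)) / 2`; its values are a priori paracomplex. -/
noncomputable def omegaC (z ξ η : Space n) : Paracomplex :=
  algebraMap ℝ Paracomplex (1 / 2) * e * ∑ j, ∑ k, algebraMap ℝ Paracomplex (S.metric z.1 j k) *
    (algebraMap ℝ Paracomplex (1 / 2) *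
      (coord ξ j * star (coord η k) - coord η j * star (coord ξ k)))

/-- The bracket of tangent vectors `{ξ, η} = (1 / 2) Im ⟨ξ, η⟩`. -/
noncomputable def vectorBracket (z ξ η : Space n) : ℝ :=
  1 / 2 * (S.hermitian z ξ η).im

/-- The differential of a smooth function on the phase space, whose tangent spaces are the ambient
vector space. -/
noncomputable def differential (f : C^∞⟮𝓘(ℝ, Space n), S.phaseSpace; 𝓘(ℝ), ℝ⟯)
    (z : S.phaseSpace) : Space n →L[ℝ] ℝ :=
  mfderiv 𝓘(ℝ, Space n) 𝓘(ℝ) f z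

end ExponentialFamily

/-! In real coordinates the form is `½ ∑ g_{jk}(x) (dy^j ⊗ dx^k - dx^k ⊗ dy^j)`, and its three
properties come from the potential. It is smooth because the moments of the `X_j` can be
differentiated under the integral sign (`exists_integrable_bound`, `hasFDerivAt_moment`). It is
closed because `g` is a Hessian, so that `∂_i g_{jk}` is totally symmetric
(`sum_fderiv_metric_comm`). It is nondegenerate because `g` is the covariance matrix of the
statistics: a null vector `v` makes `∑ v_k X_k` almost everywhere constant, so moving `β` along `v`
does not change the distribution, which forces `v = 0` (`eq_zero_of_metric_mulVec_eq_zero`).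

The rest is symplectic geometry on an open set of a finite-dimensional space: nondegeneracy gives
smooth gradients, and closedness gives the Jacobi identity (`IsSymplecticForm.jacobi`). -/

/-! ### Smooth functions on an open subset, through derivatives in the ambient space. -/

section OpenSubset

variable {V : Type*} [NormedAddCommGroup V] [NormedSpace ℝ V]
  {F : Type*} [NormedAddCommGroup F] [NormedSpace ℝ F]

namespace TopologicalSpace.Opens

theorem contMDiff_restrict_iff {D : TopologicalSpace.Opens V} {m : ℕ∞ω} {f : V → F} :
    ContMDiff 𝓘(ℝ, V) 𝓘(ℝ, F) m (fun z : D => f z) ↔ ContDiffOn ℝ m f D := by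
  constructor
  · intro H z hz
    have := (contMDiffAt_subtype_iff (f := f) (x := (⟨z, hz⟩ : D))).1 (H _)
    exact this.contDiffAt.contDiffWithinAt
  · intro H z
    exact contMDiffAt_subtype_iff.2 ((H.contDiffAt (D.isOpen.mem_nhds z.2)).contMDiffAt)

/-- The charts of `D` are restrictions of the identity of `V`, so near `z` the function read in the
charts is `f` itself. -/
theorem hasMFDerivAt_restrict {D : TopologicalSpace.Opens V} {f : V → F} {z : D} {L : V →L[ℝ] F}
    (h : HasFDerivAt f L z) : HasMFDerivAt 𝓘(ℝ, V) 𝓘(ℝ, F) (fun y : D => f y) z L := by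
  refine ⟨h.continuousAt.comp continuous_subtype_val.continuousAt, ?_⟩
  have hc := TopologicalSpace.Opens.chartAt_subtype_val_symm_eventuallyEq (H := V) D (x := z)
  have key : HasFDerivAt (writtenInExtChartAt 𝓘(ℝ, V) 𝓘(ℝ, F) z (fun y : D => f y)) L
      (z : V) := by
    refine h.congr_of_eventuallyEq ?_
    filter_upwards [hc] with y hy
    simp only [chartAt_self_eq, OpenPartialHomeomorph.refl_symm,
      OpenPartialHomeomorph.refl_apply, id, Function.comp] at hy
    simp only [writtenInExtChartAt, extChartAt, mfld_simps, Function.comp_apply]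
    rw [← hy]
    rfl
  exact key.hasFDerivWithinAt

/-- The extension by zero of a smooth function on an open set. -/
noncomputable def extendZero {D : TopologicalSpace.Opens V} (f : C^∞⟮𝓘(ℝ, V), D; 𝓘(ℝ), ℝ⟯) :
    V → ℝ :=
  Function.extend Subtype.val f 0

@[simp]
theorem extendZero_coe {D : TopologicalSpace.Opens V} (f : C^∞⟮𝓘(ℝ, V), D; 𝓘(ℝ), ℝ⟯) (z : D) :
    extendZero f z = f z :=
  Subtype.val_injective.extend_apply _ _ _

theorem restrict_extendZero {D : TopologicalSpace.Opens V} (f : C^∞⟮𝓘(ℝ, V), D; 𝓘(ℝ), ℝ⟯) :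
    (fun z : D => extendZero f z) = f :=
  funext (extendZero_coe f)

theorem contDiffOn_extendZero {D : TopologicalSpace.Opens V}
    (f : C^∞⟮𝓘(ℝ, V), D; 𝓘(ℝ), ℝ⟯) : ContDiffOn ℝ ∞ (extendZero f) D := by
  rw [← contMDiff_restrict_iff, restrict_extendZero]
  exact f.contMDiff

theorem contDiffAt_extendZero {D : TopologicalSpace.Opens V}
    (f : C^∞⟮𝓘(ℝ, V), D; 𝓘(ℝ), ℝ⟯) (z : D) : ContDiffAt ℝ ∞ (extendZero f) z :=
  (contDiffOn_extendZero f).contDiffAt (D.isOpen.mem_nhds z.2)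

theorem hasFDerivAt_extendZero {D : TopologicalSpace.Opens V}
    (f : C^∞⟮𝓘(ℝ, V), D; 𝓘(ℝ), ℝ⟯) (z : D) :
    HasFDerivAt (extendZero f) (fderiv ℝ (extendZero f) z) z :=
  ((contDiffAt_extendZero f z).differentiableAt (by simp)).hasFDerivAt

theorem mfderiv_eq_fderiv_extendZero {D : TopologicalSpace.Opens V}
    (f : C^∞⟮𝓘(ℝ, V), D; 𝓘(ℝ), ℝ⟯) (z : D) :
    mfderiv 𝓘(ℝ, V) 𝓘(ℝ) f z = fderiv ℝ (extendZero f) z := by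
  have := (hasMFDerivAt_restrict (hasFDerivAt_extendZero f z)).mfderiv
  rwa [restrict_extendZero] at this

/-- As `D` is open, derivatives at its points see only the germ; the values of the extension off `D`
never matter. -/
theorem eventuallyEq_extendZero {D : TopologicalSpace.Opens V}
    (f : C^∞⟮𝓘(ℝ, V), D; 𝓘(ℝ), ℝ⟯) {g : V → ℝ} (h : ∀ z : D, f z = g z) (z : D) :
    extendZero f =ᶠ[nhds (z : V)] g := by
  filter_upwards [D.isOpen.mem_nhds z.2] with y hy
  exact (extendZero_coe f ⟨y, hy⟩).trans (h ⟨y, hy⟩)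

/-- The smooth function on an open set given by a function on the ambient space. -/
def restrictSmooth (D : TopologicalSpace.Opens V) (f : V → ℝ) (hf : ContDiffOn ℝ ∞ f D) :
    C^∞⟮𝓘(ℝ, V), D; 𝓘(ℝ), ℝ⟯ :=
  ⟨fun z => f z, contMDiff_restrict_iff.2 hf⟩

@[simp]
theorem restrictSmooth_apply (D : TopologicalSpace.Opens V) (f : V → ℝ) (hf : ContDiffOn ℝ ∞ f D)
    (z : D) : restrictSmooth D f hf z = f z := rfl

theorem fderiv_extendZero_add {D : TopologicalSpace.Opens V}
    (f g : C^∞⟮𝓘(ℝ, V), D; 𝓘(ℝ), ℝ⟯) (z : D) :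
    fderiv ℝ (extendZero (f + g)) z = fderiv ℝ (extendZero f) z + fderiv ℝ (extendZero g) z := by
  rw [(eventuallyEq_extendZero (f + g) (g := extendZero f + extendZero g)
    (fun y => by simp) z).fderiv_eq]
  exact ((hasFDerivAt_extendZero f z).add (hasFDerivAt_extendZero g z)).fderiv

theorem fderiv_extendZero_smul {D : TopologicalSpace.Opens V} (c : ℝ)
    (f : C^∞⟮𝓘(ℝ, V), D; 𝓘(ℝ), ℝ⟯) (z : D) :
    fderiv ℝ (extendZero (c • f)) z = c • fderiv ℝ (extendZero f) z := by
  rw [(eventuallyEq_extendZero (c • f) (g := c • extendZero f) (fun y => by simp) z).fderiv_eq]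
  exact ((hasFDerivAt_extendZero f z).const_smul c).fderiv

theorem fderiv_extendZero_mul {D : TopologicalSpace.Opens V}
    (f g : C^∞⟮𝓘(ℝ, V), D; 𝓘(ℝ), ℝ⟯) (z : D) :
    fderiv ℝ (extendZero (f * g)) z =
      f z • fderiv ℝ (extendZero g) z + g z • fderiv ℝ (extendZero f) z := by
  rw [(eventuallyEq_extendZero (f * g) (g := extendZero f * extendZero g)
    (fun y => by simp) z).fderiv_eq]
  simpa using ((hasFDerivAt_extendZero f z).mul (hasFDerivAt_extendZero g z)).fderiv

end TopologicalSpace.Opens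

end OpenSubset

/-! ### Symplectic forms on an open set, their gradients and their Poisson bracket. -/

namespace Function

theorem update_zero_fin_two {V : Type*} (a b c : V) : update ![a, b] 0 c = ![c, b] := by
  ext i; fin_cases i <;> rfl

theorem update_one_fin_two {V : Type*} (a b c : V) : update ![a, b] 1 c = ![a, c] := by
  ext i; fin_cases i <;> rfl

end Function

section Symplectic

variable {V : Type*} [NormedAddCommGroup V] [NormedSpace ℝ V]

namespace ContinuousAlternatingMap

/-- The bilinear form of an alternating form of degree two. -/
noncomputable def toBilin (w : V [⋀^Fin 2]→L[ℝ] ℝ) : V →L[ℝ] V →L[ℝ] ℝ :=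
  LinearMap.mkContinuous₂
    (LinearMap.mk₂ ℝ (fun ξ η => w ![ξ, η])
      (fun a b c => by simpa only [Function.update_zero_fin_two] using w.map_update_add ![a, c] 0 a b)
      (fun t a c => by simpa only [Function.update_zero_fin_two] using w.map_update_smul ![a, c] 0 t a)
      (fun a b c => by simpa only [Function.update_one_fin_two] using w.map_update_add ![a, c] 1 b c)
      (fun t a c => by simpa only [Function.update_one_fin_two] using w.map_update_smul ![a, c] 1 t c))
    ‖w‖ (fun ξ η => by simpa [mul_assoc] using w.le_opNorm ![ξ, η])

@[simp]
theorem toBilin_apply (w : V [⋀^Fin 2]→L[ℝ] ℝ) (ξ η : V) : w.toBilin ξ η = w ![ξ, η] := rfl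

theorem map_swap_fin_two (w : V [⋀^Fin 2]→L[ℝ] ℝ) (ξ η : V) : w ![η, ξ] = -w ![ξ, η] := by
  have h := w.toAlternatingMap.map_swap ![ξ, η] (i := 0) (j := 1) (by decide)
  have e : (![ξ, η] ∘ Equiv.swap (0 : Fin 2) 1) = ![η, ξ] := by
    ext i; fin_cases i <;> simp
  rw [e] at h
  exact h

end ContinuousAlternatingMap

open ContinuousAlternatingMap TopologicalSpace.Opens

/-- The symplectic gradient of `f` with respect to a 2-form `w`: the vector field `X` with
`w (ξ, X) = df (ξ)`, if `w` is nondegenerate. -/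
noncomputable def symplecticGradient (w : V → V [⋀^Fin 2]→L[ℝ] ℝ) (f : V → ℝ) (z : V) : V :=
  -(w z).toBilin.inverse (fderiv ℝ f z)

namespace IsSymplecticForm

variable {D : TopologicalSpace.Opens V} {w : V → V [⋀^Fin 2]→L[ℝ] ℝ}

theorem symplecticGradient_add (f g : C^∞⟮𝓘(ℝ, V), D; 𝓘(ℝ), ℝ⟯) (z : D) :
    symplecticGradient w (extendZero (f + g)) z =
      symplecticGradient w (extendZero f) z + symplecticGradient w (extendZero g) z := by
  simp only [symplecticGradient, fderiv_extendZero_add, map_add]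
  abel

theorem symplecticGradient_smul (c : ℝ) (f : C^∞⟮𝓘(ℝ, V), D; 𝓘(ℝ), ℝ⟯) (z : D) :
    symplecticGradient w (extendZero (c • f)) z = c • symplecticGradient w (extendZero f) z := by
  simp only [symplecticGradient, fderiv_extendZero_smul, map_smul, smul_neg]

variable [FiniteDimensional ℝ V]

theorem contDiffOn_toBilin (hw : IsSymplecticForm D w) :
    ContDiffOn ℝ ∞ (fun z => (w z).toBilin) D := by
  simp only [contDiffOn_clm_apply, toBilin_apply]
  intro ξ η
  exact (apply ℝ V ℝ ![ξ, η]).contDiff.comp_contDiffOn hw.1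

theorem isInvertible_toBilin (hw : IsSymplecticForm D w) {z : V} (hz : z ∈ D) :
    (w z).toBilin.IsInvertible := by
  have hinj : Function.Injective (w z).toBilin.toLinearMap := by
    rw [injective_iff_map_eq_zero]
    intro ξ h
    refine hw.2.2 z hz ξ fun η => ?_
    simpa using congrArg (fun L : V →L[ℝ] ℝ => L η) h
  have hdim : Module.finrank ℝ V = Module.finrank ℝ (V →L[ℝ] ℝ) := by
    rw [← (LinearMap.toContinuousLinearMap (𝕜 := ℝ) (E := V) (F' := ℝ)).finrank_eq]
    exact Subspace.dual_finrank_eq.symm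
  exact ⟨(LinearEquiv.toContinuousLinearEquiv
    (LinearMap.linearEquivOfInjective _ hinj hdim)), by ext; rfl⟩

/-- `toBilin.inverse` solves for the first slot of `w`, whereas the gradient sits in the second;
this is the minus sign in `symplecticGradient`. -/
theorem apply_symplecticGradient (hw : IsSymplecticForm D w) (f : V → ℝ) {z : V} (hz : z ∈ D)
    (ξ : V) : w z ![ξ, symplecticGradient w f z] = fderiv ℝ f z ξ := by
  have h : (w z).toBilin ((w z).toBilin.inverse (fderiv ℝ f z)) = fderiv ℝ f z :=
    ((hw.isInvertible_toBilin hz).inverse_apply_eq.1 rfl).symm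
  rw [map_swap_fin_two, ← toBilin_apply, symplecticGradient, map_neg, h]
  simp

theorem contDiffOn_symplecticGradient (hw : IsSymplecticForm D w) {f : V → ℝ}
    (hf : ContDiffOn ℝ ∞ f D) : ContDiffOn ℝ ∞ (symplecticGradient w f) D := by
  intro z hz
  have : CompleteSpace V := FiniteDimensional.complete ℝ V
  have h1 := (hw.isInvertible_toBilin hz).contDiffAt_map_inverse (n := ∞)
  have h2 := (hw.contDiffOn_toBilin).contDiffAt (D.isOpen.mem_nhds hz)
  have h3 := (hf.contDiffAt (D.isOpen.mem_nhds hz)).fderiv_right (m := ∞) (by simp)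
  exact ((ContDiffAt.clm_apply (h1.comp z h2) h3).neg).contDiffWithinAt

/-- The closedness of a 2-form, in terms of its bilinear form. -/
theorem fderiv_toBilin_cyclic (hw : IsSymplecticForm D w) {z : V} (hz : z ∈ D) (ξ η ζ : V) :
    fderiv ℝ (fun y => (w y).toBilin) z ξ η ζ + fderiv ℝ (fun y => (w y).toBilin) z η ζ ξ +
      fderiv ℝ (fun y => (w y).toBilin) z ζ ξ η = 0 := by
  have hd : DifferentiableAt ℝ w z :=
    (hw.1.contDiffAt (D.isOpen.mem_nhds hz)).differentiableAt (by simp)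
  have hB : DifferentiableAt ℝ (fun y => (w y).toBilin) z :=
    (hw.contDiffOn_toBilin.contDiffAt (D.isOpen.mem_nhds hz)).differentiableAt (by simp)
  have key : ∀ a b : V, fderiv ℝ (fun y => w y ![a, b]) z =
      ((fderiv ℝ (fun y => (w y).toBilin) z).flip a).flip b := by
    intro a b
    have := ((hB.hasFDerivAt.clm_apply (hasFDerivAt_const a z)).clm_apply
      (hasFDerivAt_const b z)).fderiv
    simp only [toBilin_apply] at this
    rw [this]
    ext v
    simp
  have h := congrArg (fun L => L ![ξ, η, ζ]) (hw.2.1 z hz)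
  rw [extDeriv_apply hd, Fin.sum_univ_three] at h
  have e0 : (0 : Fin 3).removeNth ![ξ, η, ζ] = ![η, ζ] := by
    ext i; fin_cases i <;> rfl
  have e1 : (1 : Fin 3).removeNth ![ξ, η, ζ] = ![ξ, ζ] := by
    ext i; fin_cases i <;> rfl
  have e2 : (2 : Fin 3).removeNth ![ξ, η, ζ] = ![ξ, η] := by
    ext i; fin_cases i <;> rfl
  -- The middle term of the exterior derivative carries a minus sign, which this swap absorbs to
  -- make the sum cyclic.
  have swap : fderiv ℝ (fun y => w y ![ξ, ζ]) z = -fderiv ℝ (fun y => w y ![ζ, ξ]) z := by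
    rw [← fderiv_fun_neg]
    congr 1
    ext y
    exact map_swap_fin_two _ _ _
  rw [e0, e1, e2, swap] at h
  simp only [key] at h
  simpa using h

/-- Each term is a difference of two second derivatives plus a derivative of `w` (`main`). In the
cyclic sum the second derivatives cancel by symmetry, and the derivatives of `w` cancel by
closedness. -/
theorem jacobi (hw : IsSymplecticForm D w) {f g h : V → ℝ} (hf : ContDiffOn ℝ ∞ f D)
    (hg : ContDiffOn ℝ ∞ g D) (hh : ContDiffOn ℝ ∞ h D) {z : V} (hz : z ∈ D) :
    fderiv ℝ (fun y => fderiv ℝ h y (symplecticGradient w g y)) z (symplecticGradient w f z) +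
    fderiv ℝ (fun y => fderiv ℝ f y (symplecticGradient w h y)) z (symplecticGradient w g z) +
    fderiv ℝ (fun y => fderiv ℝ g y (symplecticGradient w f y)) z (symplecticGradient w h z) =
      0 := by
  have hB : DifferentiableAt ℝ (fun y => (w y).toBilin) z :=
    (hw.contDiffOn_toBilin.contDiffAt (D.isOpen.mem_nhds hz)).differentiableAt (by simp)
  have main : ∀ {g h : V → ℝ}, ContDiffOn ℝ ∞ g D → ContDiffOn ℝ ∞ h D → ∀ v : V,
      fderiv ℝ (fun y => fderiv ℝ h y (symplecticGradient w g y)) z v =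
        fderiv ℝ (fderiv ℝ h) z v (symplecticGradient w g z) -
        fderiv ℝ (fderiv ℝ g) z v (symplecticGradient w h z) +
        fderiv ℝ (fun y => (w y).toBilin) z v (symplecticGradient w h z)
          (symplecticGradient w g z) := by
    intro g h hg hh v
    have dg := ((hg.contDiffAt (D.isOpen.mem_nhds hz)).fderiv_right (m := ∞)
      (by simp)).differentiableAt (by simp)
    have dh := ((hh.contDiffAt (D.isOpen.mem_nhds hz)).fderiv_right (m := ∞)
      (by simp)).differentiableAt (by simp)
    have dG := ((hw.contDiffOn_symplecticGradient hg).contDiffAt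
      (D.isOpen.mem_nhds hz)).differentiableAt (by simp)
    have h1 := (dh.hasFDerivAt.clm_apply dG.hasFDerivAt).fderiv
    rw [h1]
    set G := symplecticGradient w g with hG
    set H := symplecticGradient w h with hH
    -- Differentiating `w (H z, G) = dg (H z)` with the first slot frozen at `H z` expresses `w (H
    -- z, DG v)`, and hence `dh (DG v)`, without derivatives of `G`.
    have h2 := ((hB.hasFDerivAt.clm_apply (hasFDerivAt_const (H z) z)).clm_apply
      dG.hasFDerivAt).fderiv
    have h3 := (dg.hasFDerivAt.clm_apply (hasFDerivAt_const (H z) z)).fderiv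
    have h4 : (fun y => (w y).toBilin (H z) (G y)) =ᶠ[nhds z] fun y => fderiv ℝ g y (H z) := by
      filter_upwards [D.isOpen.mem_nhds hz] with y hy
      exact hw.apply_symplecticGradient g hy _
    have h5 := congrArg (fun L : V →L[ℝ] ℝ => L v) (h2.symm.trans (h4.fderiv_eq.trans h3))
    have h6 : fderiv ℝ h z (fderiv ℝ G z v) = -(w z).toBilin (H z) (fderiv ℝ G z v) := by
      rw [← hw.apply_symplecticGradient h hz, toBilin_apply, ← map_swap_fin_two]
    simp at h5 h6 ⊢
    linarith
  rw [main hg hh, main hh hf, main hf hg]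
  have c := hw.fderiv_toBilin_cyclic hz (symplecticGradient w f z) (symplecticGradient w h z)
    (symplecticGradient w g z)
  have sym : ∀ {f : V → ℝ}, ContDiffOn ℝ ∞ f D → IsSymmSndFDerivAt ℝ f z := fun hf =>
    (hf.contDiffAt (D.isOpen.mem_nhds hz)).isSymmSndFDerivAt
      (by simpa using WithTop.coe_le_coe.2 (le_top : (2 : ℕ∞) ≤ ⊤))
  have s1 := sym hf (symplecticGradient w g z) (symplecticGradient w h z)
  have s2 := sym hg (symplecticGradient w f z) (symplecticGradient w h z)
  have s3 := sym hh (symplecticGradient w f z) (symplecticGradient w g z)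
  linarith

theorem contDiffOn_bracket (hw : IsSymplecticForm D w) {f h : V → ℝ} (hf : ContDiffOn ℝ ∞ f D)
    (hh : ContDiffOn ℝ ∞ h D) :
    ContDiffOn ℝ ∞ (fun z => fderiv ℝ h z (symplecticGradient w f z)) D :=
  (hh.fderiv_of_isOpen D.isOpen (by simp)).clm_apply (hw.contDiffOn_symplecticGradient hf)

/-- The Poisson structure of a symplectic form on an open set, `{f, h} = dh (X_f)`. -/
noncomputable def poissonStructure (hw : IsSymplecticForm D w) :
    PoissonStructure 𝓘(ℝ, V) D where
  bracket := LinearMap.mk₂ ℝ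
    (fun f h => restrictSmooth D
      (fun z => fderiv ℝ (extendZero h) z (symplecticGradient w (extendZero f) z))
      (hw.contDiffOn_bracket (contDiffOn_extendZero f) (contDiffOn_extendZero h)))
    (fun f g h => by ext z; simp [symplecticGradient_add])
    (fun c f h => by ext z; simp [symplecticGradient_smul])
    (fun f g h => by ext z; simp [fderiv_extendZero_add])
    (fun c f h => by ext z; simp [fderiv_extendZero_smul])
  alternating f := by
    ext z
    have h := hw.apply_symplecticGradient (extendZero f) z.2
      (symplecticGradient w (extendZero f) z)
    have h0 := map_swap_fin_two (w z) (symplecticGradient w (extendZero f) z)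
      (symplecticGradient w (extendZero f) z)
    simp only [LinearMap.mk₂_apply, restrictSmooth_apply]
    change _ = (0 : ℝ)
    linarith
  jacobi f g h := by
    ext z
    have key := hw.jacobi (contDiffOn_extendZero f) (contDiffOn_extendZero g)
      (contDiffOn_extendZero h) z.2
    simp only [LinearMap.mk₂_apply, ContMDiffMap.coe_add, Pi.add_apply, restrictSmooth_apply]
    rw [(eventuallyEq_extendZero _ (fun y => restrictSmooth_apply D _ _ y) z).fderiv_eq,
      (eventuallyEq_extendZero _ (fun y => restrictSmooth_apply D _ _ y) z).fderiv_eq,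
      (eventuallyEq_extendZero _ (fun y => restrictSmooth_apply D _ _ y) z).fderiv_eq]
    exact key
  leibniz f g h := by
    ext z
    simp [fderiv_extendZero_mul]
    ring

theorem poissonStructure_bracket_apply (hw : IsSymplecticForm D w)
    (f h : C^∞⟮𝓘(ℝ, V), D; 𝓘(ℝ), ℝ⟯) (z : D) :
    hw.poissonStructure.bracket f h z =
      fderiv ℝ (extendZero h) z (symplecticGradient w (extendZero f) z) := rfl

end IsSymplecticForm

end Symplectic

/-! ### Moments of the statistics and differentiation under the integral sign. -/

namespace MeasureTheory

variable {α E ι : Type*} [MeasurableSpace α] {μ : Measure α} [NormedAddCommGroup E]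
  [NormedSpace ℝ E] [Fintype ι] {c : ι → α → ℝ}

theorem integrable_sum_smul_const (p : ι → E) (hc : ∀ i, Integrable (c i) μ) :
    Integrable (fun x => ∑ i, c i x • p i) μ :=
  integrable_finsetSum _ fun i _ => (hc i).smul_const _

theorem integral_sum_smul_const [CompleteSpace E] (p : ι → E) (hc : ∀ i, Integrable (c i) μ) :
    ∫ x, ∑ i, c i x • p i ∂μ = ∑ i, (∫ x, c i x ∂μ) • p i := by
  rw [integral_finsetSum _ fun i _ => (hc i).smul_const _]
  simp only [integral_smul_const]

end MeasureTheory

namespace ExponentialFamily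

variable {Ω : Type*} [MeasurableSpace Ω] {n : ℕ} (S : ExponentialFamily Ω n)

/-- The density `exp (-∑ β^j X_j)` multiplied by the product of the statistics in a list. -/
noncomputable def momentIntegrand (l : List (Fin n)) (β : Fin n → ℝ) (x : Ω) : ℝ :=
  (l.map fun i => S.X i x).prod * Real.exp (-∑ j, β j * S.X j x)

/-- The unnormalised moment of the product of the statistics in a list. -/
noncomputable def moment (l : List (Fin n)) (β : Fin n → ℝ) : ℝ :=
  ∫ x, S.momentIntegrand l β x ∂S.μ

theorem measurable_momentIntegrand (l : List (Fin n)) (β : Fin n → ℝ) :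
    Measurable (S.momentIntegrand l β) := by
  have h : Measurable fun x => (l.map fun i => S.X i x).prod := by
    induction l with
    | nil => simp
    | cons i l ih =>
      simp only [List.map_cons, List.prod_cons]
      exact (S.measurable_X i).mul ih
  exact h.mul (Real.measurable_exp.comp
    (Finset.measurable_fun_sum _ fun j _ => (S.measurable_X j).const_mul _).neg)

theorem abs_list_prod_le (l : List (Fin n)) (x : Ω) :
    |(l.map fun i => S.X i x).prod| ≤ (∑ j, |S.X j x|) ^ l.length := by
  induction l with
  | nil => simp
  | cons i l ih =>
    simp only [List.map_cons, List.prod_cons, List.length_cons, abs_mul, pow_succ']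
    exact mul_le_mul (Finset.single_le_sum (f := fun j => |S.X j x|)
      (fun j _ => abs_nonneg _) (Finset.mem_univ i)) ih (abs_nonneg _) (by positivity)

/-- Multiply out `e^{|t|} ≤ e^t + e^{-t}` over the coordinates. The exponents on the right are
linear in `y`, so `integrable_exp` applies to each term. -/
theorem exp_sum_abs_le_sum_exp {ι : Type*} [Fintype ι] [DecidableEq ι] (y : ι → ℝ) :
    Real.exp (∑ j, |y j|) ≤
      ∑ p : ι → Bool, Real.exp (∑ j, (if p j then y j else -y j)) := by
  simp only [Real.exp_sum]
  have h := Finset.prod_univ_sum (fun _ : ι => (Finset.univ : Finset Bool))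
    (fun j b => Real.exp (if b then y j else -y j))
  rw [Fintype.piFinset_univ] at h
  rw [← h]
  refine Finset.prod_le_prod (fun j _ => (Real.exp_pos _).le) fun j _ => ?_
  simp only [Fintype.sum_bool, if_true, Bool.false_eq_true, if_false]
  have h1 := Real.exp_pos (y j)
  have h2 := Real.exp_pos (-y j)
  rcases abs_choice (y j) with h | h <;> rw [h] <;> linarith

theorem exists_integrable_bound {β₀ : Fin n → ℝ} (hβ₀ : β₀ ∈ S.Θ) :
    ∃ s ∈ nhds β₀, ∀ k : ℕ, ∃ bound : Ω → ℝ, Integrable bound S.μ ∧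
      ∀ β ∈ s, ∀ x, (∑ j, |S.X j x|) ^ k * Real.exp (-∑ j, β j * S.X j x) ≤ bound x := by
  obtain ⟨r, hr, hball⟩ := Metric.isOpen_iff.1 S.Θ.isOpen β₀ hβ₀
  -- One `ε` pays for the power, by `s ^ k ≤ k! / ε ^ k * exp (ε s)`, and another for moving `β`
  -- away from `β₀`. The corners `β₀ ± 2ε` of the resulting cube lie in the sup-norm ball of radius
  -- `r = 4ε`.
  set ε := r / 4 with hε
  have hε0 : 0 < ε := by positivity
  refine ⟨Metric.ball β₀ ε, Metric.ball_mem_nhds _ hε0, fun k => ?_⟩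
  -- The sign pattern `p` is reversed because the parameters enter the exponent with a minus sign.
  refine ⟨fun x => (k.factorial / ε ^ k) * ∑ p : Fin n → Bool,
    Real.exp (-∑ j, (β₀ j + (if p j then -(2 * ε) else 2 * ε)) * S.X j x), ?_, ?_⟩
  · refine Integrable.const_mul (integrable_finsetSum _ fun p _ => ?_) _
    refine S.integrable_exp (fun j => β₀ j + (if p j then -(2 * ε) else 2 * ε)) (hball ?_)
    rw [Metric.mem_ball, dist_pi_lt_iff hr]
    intro j
    rw [Real.dist_eq, add_sub_cancel_left]
    split_ifs <;> [rw [abs_neg]; skip] <;> rw [abs_of_pos (by positivity)] <;> linarith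
  · intro β hβ x
    set s := ∑ j, |S.X j x| with hs
    have hs0 : 0 ≤ s := Finset.sum_nonneg fun j _ => abs_nonneg _
    have h1 : s ^ k ≤ (k.factorial / ε ^ k) * Real.exp (ε * s) := by
      have := Real.pow_div_factorial_le_exp _ (mul_nonneg hε0.le hs0) k
      rw [mul_pow, div_le_iff₀ (by positivity)] at this
      rw [div_mul_eq_mul_div, le_div_iff₀ (by positivity)]
      linarith
    have h2 : -∑ j, β j * S.X j x ≤ -∑ j, β₀ j * S.X j x + ε * s := by
      rw [hs, Finset.mul_sum, ← Finset.sum_neg_distrib, ← Finset.sum_neg_distrib,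
        ← Finset.sum_add_distrib]
      refine Finset.sum_le_sum fun j _ => ?_
      have hj : |β j - β₀ j| ≤ ε := by
        rw [← Real.dist_eq]
        exact (dist_le_pi_dist β β₀ j).trans (Metric.mem_ball.1 hβ).le
      have := (neg_le_abs ((β j - β₀ j) * S.X j x)).trans_eq (abs_mul _ _)
      have := mul_le_mul_of_nonneg_right hj (abs_nonneg (S.X j x))
      linarith
    have h3 := exp_sum_abs_le_sum_exp fun j => 2 * ε * S.X j x
    have h4 : ∑ j, |2 * ε * S.X j x| = ε * s + ε * s := by
      rw [hs, ← add_mul, Finset.mul_sum]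
      refine Finset.sum_congr rfl fun j _ => ?_
      rw [abs_mul, abs_of_pos (by positivity)]
      ring
    rw [h4] at h3
    calc s ^ k * Real.exp (-∑ j, β j * S.X j x)
        ≤ ((k.factorial / ε ^ k) * Real.exp (ε * s)) *
          Real.exp (-∑ j, β₀ j * S.X j x + ε * s) :=
          mul_le_mul h1 (Real.exp_le_exp.2 h2) (Real.exp_pos _).le (by positivity)
      _ = (k.factorial / ε ^ k) *
          (Real.exp (-∑ j, β₀ j * S.X j x) * Real.exp (ε * s + ε * s)) := by
          simp only [Real.exp_add]
          ring
      _ ≤ (k.factorial / ε ^ k) * (Real.exp (-∑ j, β₀ j * S.X j x) *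
          ∑ p : Fin n → Bool, Real.exp (∑ j, (if p j then 2 * ε * S.X j x
            else -(2 * ε * S.X j x)))) := by gcongr
      _ = _ := by
          congr 1
          rw [Finset.mul_sum]
          refine Finset.sum_congr rfl fun p _ => ?_
          rw [← Real.exp_add, ← Finset.sum_neg_distrib, ← Finset.sum_add_distrib,
            ← Finset.sum_neg_distrib]
          congr 1
          refine Finset.sum_congr rfl fun j _ => ?_
          split_ifs <;> ring

theorem abs_momentIntegrand_le (l : List (Fin n)) (β : Fin n → ℝ) (x : Ω) :
    |S.momentIntegrand l β x| ≤
      (∑ j, |S.X j x|) ^ l.length * Real.exp (-∑ j, β j * S.X j x) := by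
  rw [momentIntegrand, abs_mul, abs_of_pos (Real.exp_pos _)]
  exact mul_le_mul_of_nonneg_right (S.abs_list_prod_le l x) (Real.exp_pos _).le

theorem integrable_momentIntegrand (l : List (Fin n)) {β : Fin n → ℝ} (hβ : β ∈ S.Θ) :
    Integrable (S.momentIntegrand l β) S.μ := by
  obtain ⟨s, hs, h⟩ := S.exists_integrable_bound hβ
  obtain ⟨b, hb, hle⟩ := h l.length
  exact hb.mono' (S.measurable_momentIntegrand l β).aestronglyMeasurable
    (.of_forall fun x => (S.abs_momentIntegrand_le l β x).trans (hle β (mem_of_mem_nhds hs) x))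

theorem hasFDerivAt_momentIntegrand (l : List (Fin n)) (β : Fin n → ℝ) (x : Ω) :
    HasFDerivAt (fun β => S.momentIntegrand l β x)
      (∑ i, (-S.momentIntegrand (i :: l) β x) •
        (ContinuousLinearMap.proj i : (Fin n → ℝ) →L[ℝ] ℝ)) β := by
  have h1 : HasFDerivAt (fun β : Fin n → ℝ => -∑ j, β j * S.X j x)
      (-∑ j, S.X j x • (ContinuousLinearMap.proj j : (Fin n → ℝ) →L[ℝ] ℝ)) β :=
    (HasFDerivAt.fun_sum fun j _ =>
      ((ContinuousLinearMap.proj j : (Fin n → ℝ) →L[ℝ] ℝ).hasFDerivAt (x := β)).mul_const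
        (S.X j x)).neg
  refine (h1.exp.const_mul ((l.map fun i => S.X i x).prod)).congr_fderiv ?_
  rw [smul_neg, Finset.smul_sum, smul_neg, Finset.smul_sum, ← Finset.sum_neg_distrib]
  refine Finset.sum_congr rfl fun i _ => ?_
  simp only [momentIntegrand, List.map_cons, List.prod_cons, smul_smul, ← neg_smul]
  congr 1
  ring

/-- The derivative of `momentIntegrand` with respect to the parameter. -/
noncomputable def momentIntegrandDeriv (l : List (Fin n)) (β : Fin n → ℝ) (x : Ω) :
    (Fin n → ℝ) →L[ℝ] ℝ :=
  ∑ i, (-S.momentIntegrand (i :: l) β x) • (ContinuousLinearMap.proj i : (Fin n → ℝ) →L[ℝ] ℝ)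

theorem norm_momentIntegrandDeriv_le (l : List (Fin n)) (β : Fin n → ℝ) (x : Ω) :
    ‖S.momentIntegrandDeriv l β x‖ ≤ ∑ _i : Fin n,
      (∑ j, |S.X j x|) ^ (l.length + 1) * Real.exp (-∑ j, β j * S.X j x) := by
  refine (norm_sum_le _ _).trans (Finset.sum_le_sum fun i _ => ?_)
  have hproj : ‖(ContinuousLinearMap.proj i : (Fin n → ℝ) →L[ℝ] ℝ)‖ ≤ 1 :=
    ContinuousLinearMap.opNorm_le_bound _ zero_le_one fun v => by
      simpa using norm_le_pi_norm v i
  rw [norm_smul, norm_neg, Real.norm_eq_abs]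
  exact (mul_le_of_le_one_right (abs_nonneg _) hproj).trans (S.abs_momentIntegrand_le _ _ _)

/-- Differentiating the exponential brings down `-X_i`, so moments indexed by lists are closed under
differentiation. The domination uses one power more than the length of `l`. -/
theorem hasFDerivAt_moment (l : List (Fin n)) {β : Fin n → ℝ} (hβ : β ∈ S.Θ) :
    HasFDerivAt (S.moment l)
      (∑ i, (-S.moment (i :: l) β) • (ContinuousLinearMap.proj i : (Fin n → ℝ) →L[ℝ] ℝ)) β := by
  obtain ⟨s, hs, h⟩ := S.exists_integrable_bound hβ
  obtain ⟨b, hb, hle⟩ := h (l.length + 1)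
  have hc : ∀ i, Integrable (fun x => -S.momentIntegrand (i :: l) β x) S.μ :=
    fun i => (S.integrable_momentIntegrand (i :: l) hβ).neg
  have key : HasFDerivAt (S.moment l) (∫ x, S.momentIntegrandDeriv l β x ∂S.μ) β :=
    hasFDerivAt_integral_of_dominated_of_fderiv_le (𝕜 := ℝ) hs
      (.of_forall fun β => (S.measurable_momentIntegrand l β).aestronglyMeasurable)
      (S.integrable_momentIntegrand l hβ)
      (integrable_sum_smul_const _ hc).aestronglyMeasurable
      (.of_forall fun x β' hβ' => (S.norm_momentIntegrandDeriv_le l β' x).trans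
        (Finset.sum_le_sum fun _ _ => hle β' hβ' x))
      (integrable_finsetSum Finset.univ fun _ _ => hb)
      (.of_forall fun x β' _ => S.hasFDerivAt_momentIntegrand l β' x)
  refine key.congr_fderiv ((integral_sum_smul_const _ hc).trans ?_)
  simp only [integral_neg, moment]

theorem partialD_moment (i : Fin n) (l : List (Fin n)) {β : Fin n → ℝ} (hβ : β ∈ S.Θ) :
    partialD i (S.moment l) β = -S.moment (i :: l) β := by
  rw [partialD, (S.hasFDerivAt_moment l hβ).fderiv]
  simp [Pi.single_apply]

theorem contDiffOn_moment (l : List (Fin n)) : ContDiffOn ℝ ∞ (S.moment l) S.Θ := by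
  rw [contDiffOn_infty]
  intro m
  -- All lists are treated at once, since the derivative involves longer ones.
  induction m generalizing l with
  | zero =>
    exact contDiffOn_zero.2 fun β hβ =>
      (S.hasFDerivAt_moment l hβ).continuousAt.continuousWithinAt
  | succ m ih =>
    rw [Nat.cast_add, Nat.cast_one, contDiffOn_succ_iff_fderiv_of_isOpen S.Θ.isOpen]
    refine ⟨fun β hβ => (S.hasFDerivAt_moment l hβ).differentiableAt.differentiableWithinAt,
      by simp, ?_⟩
    refine ContDiffOn.congr (f := fun β => ∑ i, (-S.moment (i :: l) β) •
      (ContinuousLinearMap.proj i : (Fin n → ℝ) →L[ℝ] ℝ)) ?_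
      fun β hβ => (S.hasFDerivAt_moment l hβ).fderiv
    exact ContDiffOn.sum fun i _ => (ih (i :: l)).neg.smul contDiffOn_const

theorem potential_eq : S.potential = fun β => Real.log (S.moment [] β) := by
  ext β
  simp [potential, moment, momentIntegrand]

theorem moment_nil_pos {β : Fin n → ℝ} (hβ : β ∈ S.Θ) : 0 < S.moment [] β := by
  have : NeZero S.μ := ⟨S.μ_ne_zero⟩
  simpa [moment, momentIntegrand] using integral_exp_pos (S.integrable_exp β hβ)

theorem contDiffOn_potential : ContDiffOn ℝ ∞ S.potential S.Θ := by
  rw [potential_eq]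
  exact (S.contDiffOn_moment []).log fun β hβ => (S.moment_nil_pos hβ).ne'

end ExponentialFamily

/-! ### The Fisher metric: symmetry, covariance formula and nondegeneracy. -/

theorem ContDiffOn.partialD {n : ℕ} {D : Set (Fin n → ℝ)} (hD : IsOpen D) {f : (Fin n → ℝ) → ℝ}
    (hf : ContDiffOn ℝ ∞ f D) (i : Fin n) : ContDiffOn ℝ ∞ (partialD i f) D :=
  (hf.fderiv_of_isOpen hD (by simp)).clm_apply contDiffOn_const

theorem Filter.EventuallyEq.partialD_eq {n : ℕ} {β : Fin n → ℝ} {f g : (Fin n → ℝ) → ℝ}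
    (h : f =ᶠ[nhds β] g) (i : Fin n) : _root_.partialD i f β = _root_.partialD i g β := by
  rw [_root_.partialD, h.fderiv_eq, _root_.partialD]

theorem partialD_comm {n : ℕ} {D : Set (Fin n → ℝ)} (hD : IsOpen D) {f : (Fin n → ℝ) → ℝ}
    (hf : ContDiffOn ℝ ∞ f D) (i j : Fin n) {β : Fin n → ℝ} (hβ : β ∈ D) :
    partialD i (partialD j f) β = partialD j (partialD i f) β := by
  have hsymm : IsSymmSndFDerivAt ℝ f β := (hf.contDiffAt (hD.mem_nhds hβ)).isSymmSndFDerivAt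
    (by simpa using WithTop.coe_le_coe.2 (le_top : (2 : ℕ∞) ≤ ⊤))
  have hd : DifferentiableAt ℝ (fderiv ℝ f) β :=
    ((hf.contDiffAt (hD.mem_nhds hβ)).fderiv_right (m := ∞) (by simp)).differentiableAt (by simp)
  have key : ∀ a b : Fin n, partialD a (partialD b f) β =
      fderiv ℝ (fderiv ℝ f) β (Pi.single a 1) (Pi.single b 1) := by
    intro a b
    have := (hd.hasFDerivAt.clm_apply (hasFDerivAt_const (Pi.single b (1 : ℝ)) β)).fderiv
    change fderiv ℝ (fun y => fderiv ℝ f y (Pi.single b 1)) β (Pi.single a 1) = _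
    rw [this]
    simp
  rw [key, key, hsymm]

namespace ExponentialFamily

variable {Ω : Type*} [MeasurableSpace Ω] {n : ℕ} (S : ExponentialFamily Ω n)

theorem contDiffOn_metric (i j : Fin n) : ContDiffOn ℝ ∞ (fun β => S.metric β i j) S.Θ :=
  (S.contDiffOn_potential.partialD S.Θ.isOpen j).partialD S.Θ.isOpen i

theorem metric_comm (i j : Fin n) {β : Fin n → ℝ} (hβ : β ∈ S.Θ) :
    S.metric β i j = S.metric β j i :=
  partialD_comm S.Θ.isOpen S.contDiffOn_potential i j hβ

/-- Together with `metric_comm` this makes `∂_i g_{jk}` totally symmetric, the source of closedness.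
-/
theorem partialD_metric_comm (i j k : Fin n) {β : Fin n → ℝ} (hβ : β ∈ S.Θ) :
    partialD i (fun β => S.metric β j k) β = partialD j (fun β => S.metric β i k) β :=
  partialD_comm S.Θ.isOpen (S.contDiffOn_potential.partialD S.Θ.isOpen k) i j hβ

theorem partialD_potential (i : Fin n) {β : Fin n → ℝ} (hβ : β ∈ S.Θ) :
    partialD i S.potential β = -(S.moment [i] β / S.moment [] β) := by
  have h := ((S.hasFDerivAt_moment [] hβ).log (S.moment_nil_pos hβ).ne').fderiv
  rw [potential_eq, partialD, h, smul_apply,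
    ← (S.hasFDerivAt_moment [] hβ).fderiv, ← partialD, partialD_moment S i [] hβ, smul_eq_mul]
  ring

/-- The right-hand side is the covariance of `X_i` and `X_j` under `p_β`. -/
theorem metric_eq (i j : Fin n) {β : Fin n → ℝ} (hβ : β ∈ S.Θ) :
    S.metric β i j = S.moment [i, j] β / S.moment [] β -
      S.moment [i] β / S.moment [] β * (S.moment [j] β / S.moment [] β) := by
  have hZ := (S.moment_nil_pos hβ).ne'
  have he : partialD j S.potential =ᶠ[nhds β] fun β => -(S.moment [j] β / S.moment [] β) := by
    filter_upwards [S.Θ.isOpen.mem_nhds hβ] with y hy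
    exact S.partialD_potential j hy
  change partialD i (partialD j S.potential) β = _
  rw [he.partialD_eq, partialD]
  have h1 := S.partialD_moment i [j] hβ
  have h2 := S.partialD_moment i [] hβ
  rw [partialD] at h1 h2
  have hd := fun l => (S.hasFDerivAt_moment l hβ).differentiableAt.hasFDerivAt
  have h := ((hd [j]).mul ((hasDerivAt_inv hZ).comp_hasFDerivAt β (hd []))).neg.fderiv
  simp only [div_eq_mul_inv]
  change fderiv ℝ (-(S.moment [j] * (Inv.inv ∘ S.moment []))) β _ = _
  rw [h]
  simp only [neg_apply, add_apply, smul_apply, Function.comp_apply, h1, h2, smul_eq_mul]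
  field_simp
  ring

/-- The number `∑ g_{jk} v_j v_k` is the variance of `∑ v_k X_k` under `p_β`. When it vanishes, the
function equals its mean almost everywhere, for `μ` as well since the density is positive. -/
theorem ae_eq_const_of_metric_mulVec_eq_zero {β : Fin n → ℝ} (hβ : β ∈ S.Θ) {v : Fin n → ℝ}
    (hv : ∀ j, ∑ k, S.metric β j k * v k = 0) :
    ∃ a : ℝ, ∀ᵐ x ∂S.μ, ∑ k, v k * S.X k x = a := by
  have hZ := S.moment_nil_pos hβ
  set Z := S.moment [] β with hZdef
  -- The mean of `∑ v_k X_k` under `p_β`.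
  set a := ∑ k, v k * (S.moment [k] β / Z) with ha
  refine ⟨a, ?_⟩
  have hexpand : ∀ x, (∑ k, v k * S.X k x - a) ^ 2 * Real.exp (-∑ j, β j * S.X j x) =
      ∑ j, ∑ k, v j * v k * S.momentIntegrand [j, k] β x -
        2 * a * ∑ k, v k * S.momentIntegrand [k] β x + a ^ 2 * S.momentIntegrand [] β x := by
    intro x
    have e1 : ∑ j, ∑ k, v j * v k * S.momentIntegrand [j, k] β x =
        (∑ k, v k * S.X k x) * (∑ k, v k * S.X k x) * Real.exp (-∑ j, β j * S.X j x) := by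
      rw [Finset.sum_mul_sum, Finset.sum_mul]
      refine Finset.sum_congr rfl fun j _ => ?_
      rw [Finset.sum_mul]
      refine Finset.sum_congr rfl fun k _ => ?_
      simp [momentIntegrand]
      ring
    have e2 : ∑ k, v k * S.momentIntegrand [k] β x =
        (∑ k, v k * S.X k x) * Real.exp (-∑ j, β j * S.X j x) := by
      rw [Finset.sum_mul]
      refine Finset.sum_congr rfl fun k _ => ?_
      simp [momentIntegrand]
      ring
    rw [e1, e2]
    simp [momentIntegrand]
    ring
  have i1 : ∀ j k, Integrable (fun x => v j * v k * S.momentIntegrand [j, k] β x) S.μ :=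
    fun j k => (S.integrable_momentIntegrand _ hβ).const_mul _
  have i1' : ∀ j, Integrable (fun x => ∑ k, v j * v k * S.momentIntegrand [j, k] β x) S.μ :=
    fun j => integrable_finsetSum _ fun k _ => i1 j k
  have i1'' : Integrable (fun x => ∑ j, ∑ k, v j * v k * S.momentIntegrand [j, k] β x) S.μ :=
    integrable_finsetSum _ fun j _ => i1' j
  have i2 : ∀ k, Integrable (fun x => v k * S.momentIntegrand [k] β x) S.μ :=
    fun k => (S.integrable_momentIntegrand _ hβ).const_mul _
  have i2' : Integrable (fun x => 2 * a * ∑ k, v k * S.momentIntegrand [k] β x) S.μ :=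
    (integrable_finsetSum _ fun k _ => i2 k).const_mul _
  have i3 : Integrable (fun x => a ^ 2 * S.momentIntegrand [] β x) S.μ :=
    (S.integrable_momentIntegrand _ hβ).const_mul _
  have i12 : Integrable (fun x => ∑ j, ∑ k, v j * v k * S.momentIntegrand [j, k] β x -
      2 * a * ∑ k, v k * S.momentIntegrand [k] β x) S.μ := i1''.sub i2'
  have hint : Integrable (fun x =>
      (∑ k, v k * S.X k x - a) ^ 2 * Real.exp (-∑ j, β j * S.X j x)) S.μ := by
    simp only [hexpand]
    exact i12.add i3
  have hval : ∫ x, (∑ k, v k * S.X k x - a) ^ 2 * Real.exp (-∑ j, β j * S.X j x) ∂S.μ =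
      ∑ j, ∑ k, v j * v k * S.moment [j, k] β - 2 * a * ∑ k, v k * S.moment [k] β +
        a ^ 2 * Z := by
    simp only [hexpand]
    rw [integral_add i12 i3, integral_sub i1'' i2', integral_const_mul,
      integral_const_mul, integral_finsetSum _ fun k _ => i2 k,
      integral_finsetSum _ fun j _ => i1' j]
    congr 2
    · refine Finset.sum_congr rfl fun j _ => ?_
      rw [integral_finsetSum _ fun k _ => i1 j k]
      exact Finset.sum_congr rfl fun k _ => integral_const_mul _ _
    · congr 1
      exact Finset.sum_congr rfl fun k _ => integral_const_mul _ _
  have hsum : ∑ k, v k * S.moment [k] β = a * Z := by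
    rw [ha, Finset.sum_mul]
    refine Finset.sum_congr rfl fun k _ => ?_
    field_simp
  have hquad : ∑ j, ∑ k, v j * v k * S.moment [j, k] β = a ^ 2 * Z := by
    have h0 : ∑ j, v j * ∑ k, S.metric β j k * v k = 0 := by simp [hv]
    have h1 : ∑ j, v j * ∑ k, S.metric β j k * v k =
        (∑ j, ∑ k, v j * v k * S.moment [j, k] β) / Z - a * a := by
      rw [ha, Finset.sum_mul_sum, Finset.sum_div, ← Finset.sum_sub_distrib]
      refine Finset.sum_congr rfl fun j _ => ?_
      rw [Finset.mul_sum, Finset.sum_div, ← Finset.sum_sub_distrib]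
      refine Finset.sum_congr rfl fun k _ => ?_
      rw [S.metric_eq j k hβ]
      ring
    rw [h1, sub_eq_zero, div_eq_iff hZ.ne'] at h0
    rw [h0]
    ring
  have hzero : ∫ x, (∑ k, v k * S.X k x - a) ^ 2 * Real.exp (-∑ j, β j * S.X j x) ∂S.μ = 0 := by
    rw [hval, hsum, hquad]
    ring
  rw [integral_eq_zero_iff_of_nonneg (fun x => by positivity) hint] at hzero
  filter_upwards [hzero] with x hx
  simpa [sub_eq_zero, (Real.exp_pos _).ne'] using hx

end ExponentialFamily

theorem MeasureTheory.Measure.tilted_add_const {α : Type*} [MeasurableSpace α] (μ : Measure α)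
    (f : α → ℝ) (c : ℝ) : μ.tilted (fun x => f x + c) = μ.tilted f := by
  simp only [Measure.tilted, Real.exp_add, integral_mul_const]
  congr 1
  ext x
  rw [mul_div_mul_right _ _ (Real.exp_pos c).ne']

namespace ExponentialFamily

variable {Ω : Type*} [MeasurableSpace Ω] {n : ℕ} (S : ExponentialFamily Ω n)

/-- For small `t ≠ 0` the point `β + t v` is still in `Θ`, and its exponent differs from that of `β`
by the constant `-t a`, which normalisation removes. Injectivity of the parametrisation gives `t v =
0`. -/
theorem eq_zero_of_metric_mulVec_eq_zero {β : Fin n → ℝ} (hβ : β ∈ S.Θ) {v : Fin n → ℝ}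
    (hv : ∀ j, ∑ k, S.metric β j k * v k = 0) : v = 0 := by
  obtain ⟨a, ha⟩ := S.ae_eq_const_of_metric_mulVec_eq_zero hβ hv
  have hcont : Filter.Tendsto (fun t : ℝ => β + t • v) (nhds 0) (nhds β) := by
    have : Continuous fun t : ℝ => β + t • v := by fun_prop
    simpa using this.tendsto 0
  have hev := (hcont.eventually (S.Θ.isOpen.mem_nhds hβ)).filter_mono
    (nhdsWithin_le_nhds (s := {0}ᶜ))
  obtain ⟨t, ht, ht0⟩ := (hev.and self_mem_nhdsWithin).exists
  have heq : S.μ.tilted (fun x => -∑ j, (β + t • v) j * S.X j x) =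
      S.μ.tilted (fun x => -∑ j, β j * S.X j x) := by
    rw [← Measure.tilted_add_const S.μ (fun x => -∑ j, β j * S.X j x) (-(t * a))]
    refine tilted_congr ?_
    filter_upwards [ha] with x hx
    rw [← hx, Finset.mul_sum, ← neg_add, ← Finset.sum_add_distrib]
    congr 1
    refine Finset.sum_congr rfl fun j _ => ?_
    simp
    ring
  have h := S.injOn_tilted ht hβ heq
  exact (smul_eq_zero.1 (add_eq_left.1 h)).resolve_left ht0

end ExponentialFamily

/-! ### The paracomplex 2-form and its real expression. -/

/-- The 2-form `(ξ, η) ↦ α(ξ) β(η) - α(η) β(ξ)`. -/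
noncomputable def wedgeCLM {V : Type*} [NormedAddCommGroup V] [NormedSpace ℝ V]
    (α β : V →L[ℝ] ℝ) : V [⋀^Fin 2]→L[ℝ] ℝ :=
  ContinuousAlternatingMap.alternatizeUncurryFin
    (α.smulRight (ContinuousAlternatingMap.ofSubsingleton ℝ V ℝ (0 : Fin 1) β))

theorem wedgeCLM_apply {V : Type*} [NormedAddCommGroup V] [NormedSpace ℝ V]
    (α β : V →L[ℝ] ℝ) (v : Fin 2 → V) :
    wedgeCLM α β v = α (v 0) * β (v 1) - α (v 1) * β (v 0) := by
  simp [wedgeCLM, ContinuousAlternatingMap.alternatizeUncurryFin_apply, Fin.sum_univ_two,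
    Fin.removeNth]
  ring

namespace Paracomplex

theorem re_sum {ι : Type*} (s : Finset ι) (f : ι → Paracomplex) :
    (∑ i ∈ s, f i).re = ∑ i ∈ s, (f i).re :=
  map_sum (⟨⟨QuadraticAlgebra.re, rfl⟩, fun _ _ => rfl⟩ : Paracomplex →+ ℝ) f s

theorem im_sum {ι : Type*} (s : Finset ι) (f : ι → Paracomplex) :
    (∑ i ∈ s, f i).im = ∑ i ∈ s, (f i).im :=
  map_sum (⟨⟨QuadraticAlgebra.im, rfl⟩, fun _ _ => rfl⟩ : Paracomplex →+ ℝ) f s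

end Paracomplex

open Paracomplex

namespace ExponentialFamily

variable {Ω : Type*} [MeasurableSpace Ω] {n : ℕ} (S : ExponentialFamily Ω n)

theorem sum_metric_comm {β : Fin n → ℝ} (hβ : β ∈ S.Θ) (u v : Fin n → ℝ) :
    ∑ j, ∑ k, S.metric β j k * (u j * v k) = ∑ j, ∑ k, S.metric β j k * (v j * u k) := by
  rw [Finset.sum_comm]
  refine Finset.sum_congr rfl fun j _ => Finset.sum_congr rfl fun k _ => ?_
  rw [S.metric_comm k j hβ]
  ring

/-- The real symplectic form `½ ∑ g_{jk}(x) (dy^j ⊗ dx^k - dx^k ⊗ dy^j)`. -/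
noncomputable def symplecticForm (z : Space n) : Space n [⋀^Fin 2]→L[ℝ] ℝ :=
  ∑ j, ∑ k, (1 / 2 * S.metric z.1 j k) •
    wedgeCLM ((ContinuousLinearMap.proj j).comp (ContinuousLinearMap.snd ℝ _ _))
      ((ContinuousLinearMap.proj k).comp (ContinuousLinearMap.fst ℝ _ _))

theorem symplecticForm_apply (z : Space n) (v : Fin 2 → Space n) :
    S.symplecticForm z v =
      1 / 2 * ∑ j, ∑ k, S.metric z.1 j k * ((v 0).2 j * (v 1).1 k - (v 1).2 j * (v 0).1 k) := by
  simp [symplecticForm, wedgeCLM_apply, Finset.mul_sum, mul_assoc]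

/-- `symplecticForm` is alternating at every `z` by construction; matching it with the Hermitian
product needs the symmetry of `g`, available only over `Θ`. -/
theorem symplecticForm_eq_of_mem {z : Space n} (hz : z ∈ S.phaseSpace) (ξ η : Space n) :
    S.symplecticForm z ![ξ, η] =
      1 / 2 * ∑ j, ∑ k, S.metric z.1 j k * (ξ.2 j * η.1 k - ξ.1 j * η.2 k) := by
  have h := S.sum_metric_comm hz ξ.1 η.2
  rw [symplecticForm_apply]
  simp only [mul_sub, Finset.sum_sub_distrib, h]
  simp

theorem symplecticForm_eq_vectorBracket {z : Space n} (hz : z ∈ S.phaseSpace) (ξ η : Space n) :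
    S.symplecticForm z ![ξ, η] = S.vectorBracket z ξ η := by
  rw [S.symplecticForm_eq_of_mem hz, vectorBracket, hermitian]
  simp only [im_sum]
  congr 1
  refine Finset.sum_congr rfl fun j _ => Finset.sum_congr rfl fun k _ => ?_
  simp [coord]
  ring

/-- As `g` is real and symmetric, the sum is a Hermitian expression minus its conjugate, so it is a
multiple of `e`; the factor `e` makes it real because `e² = 1`. -/
theorem omegaC_eq {z : Space n} (hz : z ∈ S.phaseSpace) (ξ η : Space n) :
    S.omegaC z ξ η = algebraMap ℝ Paracomplex (S.symplecticForm z ![ξ, η]) := by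
  have hre : (∑ j, ∑ k, algebraMap ℝ Paracomplex (S.metric z.1 j k) *
      (algebraMap ℝ Paracomplex (1 / 2) *
        (coord ξ j * star (coord η k) - coord η j * star (coord ξ k)))).re = 0 := by
    have e : ∀ j k, (algebraMap ℝ Paracomplex (S.metric z.1 j k) *
        (algebraMap ℝ Paracomplex (1 / 2) *
          (coord ξ j * star (coord η k) - coord η j * star (coord ξ k)))).re =
        1 / 2 * (S.metric z.1 j k * (ξ.1 j * η.1 k) - S.metric z.1 j k * (η.1 j * ξ.1 k) -
          (S.metric z.1 j k * (ξ.2 j * η.2 k) - S.metric z.1 j k * (η.2 j * ξ.2 k))) := by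
      intro j k
      simp [coord]
      ring
    simp only [re_sum, e, ← Finset.mul_sum, Finset.sum_sub_distrib]
    rw [S.sum_metric_comm hz ξ.1 η.1, S.sum_metric_comm hz ξ.2 η.2]
    ring
  have him : (∑ j, ∑ k, algebraMap ℝ Paracomplex (S.metric z.1 j k) *
      (algebraMap ℝ Paracomplex (1 / 2) *
        (coord ξ j * star (coord η k) - coord η j * star (coord ξ k)))).im =
      ∑ j, ∑ k, S.metric z.1 j k * (ξ.2 j * η.1 k - ξ.1 j * η.2 k) := by
    have e : ∀ j k, (algebraMap ℝ Paracomplex (S.metric z.1 j k) *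
        (algebraMap ℝ Paracomplex (1 / 2) *
          (coord ξ j * star (coord η k) - coord η j * star (coord ξ k)))).im =
        1 / 2 * (S.metric z.1 j k * (ξ.2 j * η.1 k) - S.metric z.1 j k * (ξ.1 j * η.2 k) -
          (S.metric z.1 j k * (η.2 j * ξ.1 k) - S.metric z.1 j k * (η.1 j * ξ.2 k))) := by
      intro j k
      simp [coord]
      ring
    simp only [im_sum, e, ← Finset.mul_sum]
    simp only [mul_sub (S.metric _ _ _), Finset.sum_sub_distrib]
    rw [S.sum_metric_comm hz η.2 ξ.1, S.sum_metric_comm hz η.1 ξ.2]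
    ring
  rw [S.symplecticForm_eq_of_mem hz, omegaC, ← him]
  generalize (∑ j, ∑ k, algebraMap ℝ Paracomplex (S.metric z.1 j k) *
    (algebraMap ℝ Paracomplex (1 / 2) *
      (coord ξ j * star (coord η k) - coord η j * star (coord ξ k)))) = t at hre
  apply QuadraticAlgebra.ext
  · simp [e]
  · simp [e, hre]

/-- Pairing with `(e_i, 0)` isolates the `i`-th entry of `g ξ.2`, and pairing with `(0, e_i)` that
of `g ξ.1`. -/
theorem nondegenerate_symplecticForm {z : Space n} (hz : z ∈ S.phaseSpace) {ξ : Space n}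
    (h : ∀ η, S.symplecticForm z ![ξ, η] = 0) : ξ = 0 := by
  simp only [S.symplecticForm_eq_of_mem hz] at h
  have h2 : ξ.2 = 0 := S.eq_zero_of_metric_mulVec_eq_zero hz fun i => by
    have := h (Pi.single i 1, 0)
    simp [Pi.single_apply] at this
    simpa [S.metric_comm i _ hz] using this
  have h1 : ξ.1 = 0 := S.eq_zero_of_metric_mulVec_eq_zero hz fun i => by
    have := h (0, Pi.single i 1)
    simp [Pi.single_apply] at this
    simpa [S.metric_comm i _ hz] using this
  exact Prod.ext h1 h2

theorem contDiffOn_symplecticForm : ContDiffOn ℝ ∞ S.symplecticForm S.phaseSpace := by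
  refine ContDiffOn.sum fun j _ => ContDiffOn.sum fun k _ => ?_
  have hg : ContDiffOn ℝ ∞ (fun z : Space n => S.metric z.1 j k) S.phaseSpace :=
    (S.contDiffOn_metric j k).comp contDiff_fst.contDiffOn fun z hz => hz
  exact (contDiffOn_const.mul hg).smul contDiffOn_const

theorem fderiv_eq_sum_partialD {f : (Fin n → ℝ) → ℝ} (β v : Fin n → ℝ) :
    fderiv ℝ f β v = ∑ i, v i * partialD i f β := by
  conv_lhs => rw [pi_eq_sum_univ' v, map_sum]
  simp [partialD]

theorem sum_fderiv_metric_comm {β : Fin n → ℝ} (hβ : β ∈ S.Θ) (u x y : Fin n → ℝ) :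
    ∑ j, ∑ k, fderiv ℝ (fun β => S.metric β j k) β u * (x j * y k) =
      ∑ j, ∑ k, fderiv ℝ (fun β => S.metric β j k) β y * (x j * u k) := by
  refine Finset.sum_congr rfl fun j _ => ?_
  simp only [fderiv_eq_sum_partialD, Finset.sum_mul]
  rw [Finset.sum_comm]
  refine Finset.sum_congr rfl fun i _ => Finset.sum_congr rfl fun k _ => ?_
  have hc : ∀ i k : Fin n, (fun β => S.metric β j k) =ᶠ[nhds β] fun β => S.metric β k j := by
    intro i k
    filter_upwards [S.Θ.isOpen.mem_nhds hβ] with y hy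
    exact S.metric_comm j k hy
  -- The symmetry of `g` moves the fixed index `j` to the last place; the other two indices are then
  -- interchanged as orders of differentiation.
  rw [(hc i k).partialD_eq, (hc k i).partialD_eq, S.partialD_metric_comm i k j hβ]
  ring

theorem fderiv_symplecticForm_apply {z : Space n} (hz : z ∈ S.phaseSpace) (v : Fin 2 → Space n)
    (ζ : Space n) :
    fderiv ℝ (fun y => S.symplecticForm y v) z ζ = 1 / 2 *
      (∑ j, ∑ k, fderiv ℝ (fun β => S.metric β j k) z.1 ζ.1 * ((v 0).2 j * (v 1).1 k) -
        ∑ j, ∑ k, fderiv ℝ (fun β => S.metric β j k) z.1 ζ.1 * ((v 1).2 j * (v 0).1 k)) := by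
  have hg : ∀ j k, HasFDerivAt (fun y : Space n => S.metric y.1 j k)
      ((fderiv ℝ (fun β => S.metric β j k) z.1).comp (ContinuousLinearMap.fst ℝ _ _)) z :=
    fun j k => (((S.contDiffOn_metric j k).contDiffAt
      (S.Θ.isOpen.mem_nhds hz)).differentiableAt (by simp)).hasFDerivAt.comp z hasFDerivAt_fst
  have h := ((HasFDerivAt.fun_sum fun j (_ : j ∈ Finset.univ) =>
    HasFDerivAt.fun_sum fun k (_ : k ∈ Finset.univ) => (hg j k).mul_const
      ((v 0).2 j * (v 1).1 k - (v 1).2 j * (v 0).1 k)).const_mul (1 / 2)).fderiv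
  simp only [symplecticForm_apply]
  rw [h]
  simp only [← Finset.sum_sub_distrib, ← mul_sub]
  simp [mul_comm]

/-- The six terms cancel in pairs: two terms with the same `y`-component differ by exchanging the
direction of differentiation with the `x`-component. -/
theorem extDeriv_symplecticForm {z : Space n} (hz : z ∈ S.phaseSpace) :
    extDeriv S.symplecticForm z = 0 := by
  ext v
  rw [extDeriv_apply ((S.contDiffOn_symplecticForm.contDiffAt
    (S.phaseSpace.isOpen.mem_nhds hz)).differentiableAt (by simp)), Fin.sum_univ_three]
  simp only [S.fderiv_symplecticForm_apply hz]
  have e0 : (0 : Fin 3).removeNth v = ![v 1, v 2] := by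
    ext i <;> fin_cases i <;> rfl
  have e1 : (1 : Fin 3).removeNth v = ![v 0, v 2] := by
    ext i <;> fin_cases i <;> rfl
  have e2 : (2 : Fin 3).removeNth v = ![v 0, v 1] := by
    ext i <;> fin_cases i <;> rfl
  have c0 := S.sum_fderiv_metric_comm hz (v 0).1 (v 1).2 (v 2).1
  have c1 := S.sum_fderiv_metric_comm hz (v 0).1 (v 2).2 (v 1).1
  have c2 := S.sum_fderiv_metric_comm hz (v 1).1 (v 0).2 (v 2).1
  rw [e0, e1, e2]
  simp only [Matrix.cons_val_zero, Matrix.cons_val_one, c0, c1, c2]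
  simp
  ring

theorem isSymplecticForm_symplecticForm : IsSymplecticForm S.phaseSpace S.symplecticForm :=
  ⟨S.contDiffOn_symplecticForm, fun _ hz => S.extDeriv_symplecticForm hz,
    fun _ hz _ h => S.nondegenerate_symplecticForm hz h⟩

end ExponentialFamily

theorem mainTheorem3 {Ω : Type*} [MeasurableSpace Ω] {n : ℕ} (S : ExponentialFamily Ω n)
    (hS : S.IsFrobenius) :
    -- the 2-form is real valued, symplectic, and equal to half the imaginary part of the
    -- paracomplex Hermitian product
    ∃ w : Paracomplex.Space n → (Paracomplex.Space n) [⋀^Fin 2]→L[ℝ] ℝ,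
      IsSymplecticForm S.phaseSpace w ∧
      (∀ z ∈ S.phaseSpace, ∀ ξ η : Paracomplex.Space n,
        S.omegaC z ξ η = algebraMap ℝ Paracomplex (w z ![ξ, η]) ∧
        w z ![ξ, η] = S.vectorBracket z ξ η) ∧
      -- symplectic gradients of smooth functions, and the Poisson structure they define
      ∃ (grad : C^∞⟮𝓘(ℝ, Paracomplex.Space n), S.phaseSpace; 𝓘(ℝ), ℝ⟯ →
            S.phaseSpace → Paracomplex.Space n)
        (P : PoissonStructure 𝓘(ℝ, Paracomplex.Space n) S.phaseSpace),
        (∀ f, ContMDiff 𝓘(ℝ, Paracomplex.Space n) 𝓘(ℝ, Paracomplex.Space n) ∞ (grad f)) ∧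
        (∀ f (z : S.phaseSpace) (ξ : Paracomplex.Space n),
          w z ![ξ, grad f z] = S.differential f z ξ) ∧
        ∀ f h (z : S.phaseSpace),
          P.bracket f h z = S.differential h z (grad f z) ∧
          P.bracket f h z = S.vectorBracket z (grad f z) (grad h z) := by
  have hw := S.isSymplecticForm_symplecticForm
  have hd : ∀ f (z : S.phaseSpace), S.differential f z = fderiv ℝ (TopologicalSpace.Opens.extendZero f) z :=
    fun f z => TopologicalSpace.Opens.mfderiv_eq_fderiv_extendZero f z
  refine ⟨S.symplecticForm, hw, fun z hz ξ η =>
    ⟨S.omegaC_eq hz ξ η, S.symplecticForm_eq_vectorBracket hz ξ η⟩,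
    fun f z => symplecticGradient S.symplecticForm (TopologicalSpace.Opens.extendZero f) z, hw.poissonStructure,
    fun f => ?_, fun f z ξ => ?_, fun f h z => ⟨?_, ?_⟩⟩
  · exact TopologicalSpace.Opens.contMDiff_restrict_iff.2 (hw.contDiffOn_symplecticGradient (TopologicalSpace.Opens.contDiffOn_extendZero f))
  · rw [hd]
    exact hw.apply_symplecticGradient _ z.2 ξ
  · rw [hd, hw.poissonStructure_bracket_apply]
  -- The gradient of `h` in the second slot turns `w (X_f, X_h)` into `dh (X_f)`.
  · rw [← S.symplecticForm_eq_vectorBracket z.2, hw.apply_symplecticGradient _ z.2,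
      hw.poissonStructure_bracket_apply]
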